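/- Let $k\ge 2$. The language $\mathrm{PCF}\langle X_1,\dots,X_k\rangle$ has types $A::=\mathrm{Bool}\mid\mathbf N\mid A\to A$ and terms $$M::=\mathsf 0\mid \mathsf{succ}\,M\mid\mathsf{pred}\,M\mid\mathsf{ifz}(M,M,M)\mid x\mid\lambda x.M\mid MM\mid \mathrm Y M\mid M\oplus_{X_j}M\qquad(1\le j\le k),$$ with $\mathsf 1:=\mathsf{succ}\,\mathsf 0$. Typing is the usual one of PCF; moreover $\mathsf 0,\mathsf 1:\mathrm{Bool}$, every term of type $\mathrm{Bool}$ has type $\mathbf N$, and $M\oplus_{X_j}N:A$ whenever $M,N:A$. Terms are interpreted in the weighted relational semantics over the continuous semiring $\mathbb N^\infty\{\!\{\mathbb X\}\!\}$ of formal power series with coefficients in $\mathbb N^\infty=\mathbb N\cup\{\infty\}$ and variables $\mathbb X=\{X_1,\overline{X_1},\dots,X_k,\overline{X_k}\}$: one has $[\![\mathrm{Bool}]\!]=\{0,1\}$, $[\![\mathbf N]\!]=\mathbb N$, $[\![A\to B]\!]={!}[\![A]\!]\times[\![B]\!]$ (where $!$ denotes finite multisets), and a typing derivation of $\Gamma\vdash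 M:A$ is interpreted as a $[\![A]\!]$-indexed family of power series over $\mathbb N^\infty\{\!\{\mathbb X\}\!\}$ in the variables $[\![\Gamma]\!]$, with $[\![M\oplus_{X_j}N]\!]=X_j[\![M]\!]+\overline{X_j}[\![N]\!]$ and with $\mathrm Y$ interpreted by least fixpoints. In particular, a closed term $M:\mathrm{Bool}$ gives two power series $[\![M]\!]_0,[\![M]\!]_1\in\mathbb N^\infty\{\!\{\mathbb X\}\!\}$. Let $\mathbb T=[0,\infty]$ be the tropical semiring, with $\min$ as sum and $+$ as product (and $0\cdot\infty=0$). The tropicalization of a power series $s\in\mathbb N^\infty\{\!\{\mathbb X\}\!\}$ is the function $\mathsf t^!s:\mathbb T^{\mathbb X}\to\mathbb T$, $\mathsf t^!s(x)=\inf_{\mu\in\mathrm{supp}(s)}\sum_{a\in\mathbb X}\mu(a)x_a$. For $i\in\{0,1\}$ and a closed $M:\mathrm{Bool}$, the tropical degree $\mathfrak d_i(M)\in\mathbb N$ is the minimum degree of a tropical polynomial $p$ over $\mathbb T$ in the variables $\mathbb X$, all of whose coefficients are the $0$ or the $1$ of $\mathbb T$, such that $\mathrm{supp}(p)\subseteq\mathrm{supp}([\![M]\!]_i)$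 and such that the function $\mathbb T^{\mathbb X}\to\mathbb T$ defined by $p$ is $\mathsf t^![\![M]\!]_i$ (the zero polynomial has degree $0$). **Theorem.** Let $k\ge2$ and $i\in\{0,1\}$. Consider the following two decision problems, whose input is a number $d\in\mathbb N$ and (the Gödel number of) a closed term $M:\mathrm{Bool}$ of $\mathrm{PCF}\langle X_1,\dots,X_k\rangle$, given with a typing derivation: 1. is $\mathfrak d_i(M)<d$? 2. is $\mathfrak d_i(M)=d$? Neither problem is recursively enumerable, and both are $\Pi^0_1$-hard: every $\Pi^0_1$ set of natural numbers is many-one reducible, by a computable function, to each of them. -/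

import Mathlib

open scoped ENNReal

noncomputable section

namespace PCFX

/-! ### Syntax: the language `PCF⟨X₁,…,X_k⟩` -/

/-- Types `A ::= Bool | N | A → A`. -/
inductive Ty : Type
  | bool : Ty
  | nat : Ty
  | arr : Ty → Ty → Ty

/-- `Var Γ A`: a variable declared with type `A` in the context `Γ` (de Bruijn style). -/
inductive Var : List Ty → Ty → Type
  | here {Γ : List Ty} {A : Ty} : Var (A :: Γ) A
  | there {Γ : List Ty} {A B : Ty} : Var Γ A → Var (B :: Γ) A

/-- `Tm k Γ A`: terms (up to `α`-equivalence) with parameters `X₁,…,X_k`, together with a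
derivation of the judgement `Γ ⊢ M : A`. There is one constructor for each typing rule; the rule
`cast` is the inclusion of `Bool` in `N`. A closed term `M : Bool` is an element of
`Tm k [] Ty.bool`. -/
inductive Tm (k : ℕ) : List Ty → Ty → Type
  | zero {Γ : List Ty} : Tm k Γ Ty.nat
  | succ {Γ : List Ty} (M : Tm k Γ Ty.nat) : Tm k Γ Ty.nat
  | pred {Γ : List Ty} (M : Tm k Γ Ty.nat) : Tm k Γ Ty.nat
  | bool0 {Γ : List Ty} : Tm k Γ Ty.bool
  | bool1 {Γ : List Ty} : Tm k Γ Ty.bool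
  | cast {Γ : List Ty} (M : Tm k Γ Ty.bool) : Tm k Γ Ty.nat
  | var {Γ : List Ty} {A : Ty} (x : Var Γ A) : Tm k Γ A
  | lam {Γ : List Ty} {A B : Ty} (M : Tm k (A :: Γ) B) : Tm k Γ (Ty.arr A B)
  | app {Γ : List Ty} {A B : Ty} (M : Tm k Γ (Ty.arr A B)) (N : Tm k Γ A) : Tm k Γ B
  | ifz {Γ : List Ty} {A : Ty} (M : Tm k Γ Ty.nat) (N P : Tm k Γ A) : Tm k Γ A
  | choice {Γ : List Ty} {A : Ty} (i : Fin k) (M N : Tm k Γ A) : Tm k Γ A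
  | fix {Γ : List Ty} {A : Ty} (M : Tm k Γ (Ty.arr A A)) : Tm k Γ A

/-! ### Gödel numbering -/

/-- Gödel number of a type. -/
def Ty.code : Ty → ℕ
  | .bool => Nat.pair 0 0
  | .nat => Nat.pair 1 0
  | .arr A B => Nat.pair 2 (Nat.pair A.code B.code)

/-- The de Bruijn index of a variable. -/
def Var.code {Γ : List Ty} {A : Ty} : Var Γ A → ℕ
  | .here => 0
  | .there x => x.code + 1

/-- Gödel number of a typed term. -/
def Tm.code {k : ℕ} {Γ : List Ty} {A : Ty} : Tm k Γ A → ℕ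
  | .zero => Nat.pair 0 0
  | .succ M => Nat.pair 1 M.code
  | .pred M => Nat.pair 2 M.code
  | .bool0 => Nat.pair 3 0
  | .bool1 => Nat.pair 4 0
  | .cast M => Nat.pair 5 M.code
  | .var x => Nat.pair 6 x.code
  | .lam M => Nat.pair 7 M.code
  | .app (A := A) M N => Nat.pair 8 (Nat.pair A.code (Nat.pair M.code N.code))
  | .ifz M N P => Nat.pair 9 (Nat.pair M.code (Nat.pair N.code P.code))
  | .choice i M N => Nat.pair 10 (Nat.pair i (Nat.pair M.code N.code))
  | .fix M => Nat.pair 11 M.code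

theorem Ty.code_injective {A B : Ty} (h : A.code = B.code) : A = B := by
  induction A generalizing B with
  | bool => cases B <;> simp [Ty.code, Nat.pair_eq_pair] at h ⊢
  | nat => cases B <;> simp [Ty.code, Nat.pair_eq_pair] at h ⊢
  | arr A₁ A₂ ih₁ ih₂ =>
    cases B <;> simp [Ty.code, Nat.pair_eq_pair] at h ⊢
    exact ⟨ih₁ h.1, ih₂ h.2⟩

theorem Var.code_injective {Γ : List Ty} {A : Ty} {x y : Var Γ A} (h : x.code = y.code) :
    x = y := by
  induction x with
  | here => cases y <;> simp [Var.code] at h ⊢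
  | there x ih =>
    cases y <;> simp [Var.code] at h ⊢
    exact ih h

/-- Distinct typed terms (of the same type, in the same context) have distinct codes. -/
theorem Tm.code_injective {k : ℕ} {Γ : List Ty} {A : Ty} {M N : Tm k Γ A}
    (h : M.code = N.code) : M = N := by
  induction M with
  | zero => cases N <;> simp [Tm.code, Nat.pair_eq_pair] at h ⊢
  | succ M ih => cases N <;> simp [Tm.code, Nat.pair_eq_pair] at h ⊢; exact ih h
  | pred M ih => cases N <;> simp [Tm.code, Nat.pair_eq_pair] at h ⊢; exact ih h
  | bool0 => cases N <;> simp [Tm.code, Nat.pair_eq_pair] at h ⊢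
  | bool1 => cases N <;> simp [Tm.code, Nat.pair_eq_pair] at h ⊢
  | cast M ih => cases N <;> simp [Tm.code, Nat.pair_eq_pair] at h ⊢; exact ih h
  | var x =>
    cases N <;> simp [Tm.code, Nat.pair_eq_pair] at h ⊢; exact Var.code_injective h
  | lam M ih => cases N <;> simp [Tm.code, Nat.pair_eq_pair] at h ⊢; exact ih h
  | app M₁ M₂ ih₁ ih₂ =>
    cases N <;> simp [Tm.code, Nat.pair_eq_pair] at h
    obtain ⟨h₀, h₁, h₂⟩ := h
    obtain rfl := Ty.code_injective h₀
    rw [ih₁ h₁, ih₂ h₂]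
  | ifz M₁ M₂ M₃ ih₁ ih₂ ih₃ =>
    cases N <;> simp [Tm.code, Nat.pair_eq_pair] at h ⊢
    exact ⟨ih₁ h.1, ih₂ h.2.1, ih₃ h.2.2⟩
  | choice i M₁ M₂ ih₁ ih₂ =>
    cases N <;> simp [Tm.code, Nat.pair_eq_pair] at h ⊢
    exact ⟨Fin.ext h.1, ih₁ h.2.1, ih₂ h.2.2⟩
  | fix M ih => cases N <;> simp [Tm.code, Nat.pair_eq_pair] at h ⊢; exact ih h

/-! ### Parametric weighted relational semantics -/

/-- The interpretation of types: `⟦Bool⟧ = {0,1}`, `⟦N⟧ = ℕ`, `⟦A → B⟧ = !⟦A⟧ × ⟦B⟧`, where the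
finite multisets `!Σ` are the finitely supported functions `Σ → ℕ`. -/
def Pt : Ty → Type
  | .bool => Fin 2
  | .nat => ℕ
  | .arr A B => (Pt A →₀ ℕ) × Pt B

/-- The `2k` formal parameters: `(i, true)` stands for `X_i` and `(i, false)` for its companion
`X̄_i`. -/
abbrev Param (k : ℕ) : Type := Fin k × Bool

/-- The formal variables of the power series that interpret terms in context `Γ = A₁,…,A_n`:
the disjoint union of the parameters and of the sets `⟦A₁⟧, …, ⟦A_n⟧`. -/
def FVar (k : ℕ) : List Ty → Type
  | [] => Param k
  | A :: Γ => Pt A ⊕ FVar k Γ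

/-- A parameter as a formal variable in context `Γ`. -/
def FVar.param {k : ℕ} (p : Param k) : (Γ : List Ty) → FVar k Γ
  | [] => p
  | _ :: Γ => Sum.inr (FVar.param p Γ)

/-- The formal variable `x_a`, for `x : A` declared in `Γ` and `a ∈ ⟦A⟧`. -/
def Var.point (k : ℕ) {Γ : List Ty} {A : Ty} : Var Γ A → Pt A → FVar k Γ
  | .here, a => Sum.inl a
  | .there x, a => Sum.inr (x.point k a)

/-- Formal power series over the continuous semiring `ℕ∞`, with variables in `V`. -/
abbrev FPS (V : Type) : Type := MvPowerSeries V ℕ∞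

/-- Infinite sums of formal power series: coefficient by coefficient, the supremum in `ℕ∞` of the
finite partial sums. -/
def FPS.infSum {V ι : Type} (f : ι → FPS V) : FPS V :=
  fun ν => ⨆ s : Finset ι, ∑ j ∈ s, MvPowerSeries.coeff ν (f j)

/-- Pointwise suprema of sequences of formal power series. -/
def FPS.sup {V : Type} (f : ℕ → FPS V) : FPS V :=
  fun ν => ⨆ n, MvPowerSeries.coeff ν (f n)

/-- Application: `(f g)_b = ∑_{m ∈ !⟦A⟧} f_{(m,b)} · g^m`, with `g^m = ∏_a g_a ^ m(a)`. -/
def applySeries {V : Type} {A B : Ty} (f : Pt (Ty.arr A B) → FPS V) (g : Pt A → FPS V) :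
    Pt B → FPS V :=
  fun b => FPS.infSum fun m : Pt A →₀ ℕ => f (m, b) * m.prod fun a n => g a ^ n

/-- The approximants of the least fixpoint of `g ↦ f g`, starting from `0`. -/
def fixIter {V : Type} {A : Ty} (f : Pt (Ty.arr A A) → FPS V) : ℕ → Pt A → FPS V
  | 0 => fun _ => 0
  | n + 1 => applySeries f (fixIter f n)

/-- The parametric interpretation of (the typing derivation of) a term `Γ ⊢ M : A`: a
`⟦A⟧`-indexed family of formal power series over `ℕ∞`, in the parameters and the variables from
`⟦Γ⟧`. -/
def Tm.interp {k : ℕ} {Γ : List Ty} {A : Ty} : Tm k Γ A → Pt A → FPS (FVar k Γ)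
  | .zero => fun n : ℕ => if n = 0 then 1 else 0
  | .succ M => fun n : ℕ => match n with
    | 0 => 0
    | n + 1 => M.interp n
  | .pred M => fun n : ℕ => match n with
    | 0 => M.interp (0 : ℕ) + M.interp (1 : ℕ)
    | n + 1 => M.interp (n + 2 : ℕ)
  | .bool0 => fun b : Fin 2 => if b = 0 then 1 else 0
  | .bool1 => fun b : Fin 2 => if b = 1 then 1 else 0
  | .cast M => fun n : ℕ => if h : n < 2 then M.interp (⟨n, h⟩ : Fin 2) else 0
  | .var x => fun a => MvPowerSeries.X (x.point k a)
  | .lam M => fun mb ν => MvPowerSeries.coeff (Finsupp.sumElim mb.1 ν) (M.interp mb.2)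
  | .app M N => applySeries M.interp N.interp
  | .ifz M N P => fun a =>
      M.interp (0 : ℕ) * N.interp a + FPS.infSum fun n : ℕ => M.interp (n + 1 : ℕ) * P.interp a
  | .choice i M N => fun a =>
      MvPowerSeries.X (FVar.param (i, true) _) * M.interp a +
        MvPowerSeries.X (FVar.param (i, false) _) * N.interp a
  | .fix M => fun a => FPS.sup fun n => fixIter M.interp n a

/-- The series `⟦M⟧_i ∈ ℕ∞⟦X₁, X̄₁, …, X_k, X̄_k⟧`, for a closed term `M : Bool` and
`i ∈ {0,1}`. -/
def Tm.series {k : ℕ} (M : Tm k [] Ty.bool) (i : Fin 2) : FPS (Param k) := M.interp i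

/-! ### Tropicalization and tropical degree -/

/-- The tropical semiring: `[0,∞]` with `min` as sum and `+` as product. -/
abbrev Trop : Type := Tropical ℝ≥0∞

/-- The support of a formal power series. -/
def FPS.supp {V Q : Type} [Semiring Q] (s : MvPowerSeries V Q) : Set (V →₀ ℕ) :=
  {μ | MvPowerSeries.coeff μ s ≠ 0}

/-- The tropical analytic function `s^!` of a tropical power series `s`: it maps `x` to the
infinite tropical sum (that is, the infimum) of the `s_μ · x^μ`. -/
def evalTrop {V : Type} (s : MvPowerSeries V Trop) (x : V → Trop) : Trop :=
  Tropical.trop (⨅ μ : V →₀ ℕ,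
    Tropical.untrop (MvPowerSeries.coeff μ s * μ.prod fun a n => x a ^ n))

open Classical in
/-- The all-one tropical series with the same support as `s`. -/
def tropSeries {V : Type} (s : FPS V) : MvPowerSeries V Trop :=
  fun μ => if μ ∈ FPS.supp s then 1 else 0

/-- A tropical polynomial is all-one if its coefficients are the `0` or `1` of the semiring. -/
def AllOne {V : Type} (p : MvPolynomial V Trop) : Prop :=
  ∀ μ, p.coeff μ = 0 ∨ p.coeff μ = 1

/-- The degrees of the all-one tropical polynomials `p` such that `p^!` is the tropicalization
of `s`, and the support of `p` is contained in that of `s`. -/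
def degreeSet {V : Type} (s : FPS V) : Set ℕ :=
  {n | ∃ p : MvPolynomial V Trop, AllOne p ∧
    evalTrop (p : MvPowerSeries V Trop) = evalTrop (tropSeries s) ∧
    FPS.supp (p : MvPowerSeries V Trop) ⊆ FPS.supp s ∧ p.totalDegree = n}

/-- The tropical degree of `M` at `i`: the minimum of `degreeSet ⟦M⟧_i`, which is not empty by
`degreeSet_nonempty`. -/
def Tm.tropDegree {k : ℕ} (M : Tm k [] Ty.bool) (i : Fin 2) : ℕ := sInf (degreeSet (M.series i))

theorem evalTrop_anti {V : Type} (x : V → Trop) {μ ν : V →₀ ℕ} (h : μ ≤ ν) :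
    Tropical.untrop (μ.prod fun a n => x a ^ n) ≤
      Tropical.untrop (ν.prod fun a n => x a ^ n) := by
  obtain ⟨ρ, rfl⟩ := exists_add_of_le h
  rw [Finsupp.prod_add_index' (by simp) (by simp [pow_add]), Tropical.untrop_mul]
  exact le_self_add

/-- The minimum that defines the tropical degree exists. -/
theorem degreeSet_nonempty {V : Type} [Finite V] (s : FPS V) : (degreeSet s).Nonempty := by
  classical
  set S : Set (V →₀ ℕ) := {μ | Minimal (· ∈ FPS.supp s) μ} with hS
  have hfin : S.Finite :=
    (setOfPred_minimal_antichain (· ∈ FPS.supp s)).finite_of_wellQuasiOrdered wellQuasiOrdered_le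
  set p : MvPolynomial V Trop := ∑ μ ∈ hfin.toFinset, MvPolynomial.monomial μ 1 with hp
  have hc : ∀ μ, p.coeff μ = if μ ∈ S then 1 else 0 := by
    intro μ
    simp [hp, MvPolynomial.coeff_sum, MvPolynomial.coeff_monomial]
  refine ⟨p.totalDegree, p, ?_, ?_, ?_, rfl⟩
  · intro μ
    rw [hc]
    split_ifs <;> simp
  · funext x
    have hp' : ∀ μ, MvPowerSeries.coeff μ (p : MvPowerSeries V Trop) = if μ ∈ S then 1 else 0 :=
      fun μ => by rw [MvPolynomial.coeff_coe, hc]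
    have hs' : ∀ μ, MvPowerSeries.coeff μ (tropSeries s) =
        if μ ∈ FPS.supp s then 1 else 0 := fun μ => rfl
    unfold evalTrop
    congr 1
    apply le_antisymm
    · refine le_iInf fun μ => ?_
      rw [hs']
      split_ifs with hμ
      · obtain ⟨m, hm, hmin⟩ := exists_minimal_le_of_wellFoundedLT (· ∈ FPS.supp s) μ hμ
        refine (iInf_le _ m).trans ?_
        rw [hp', if_pos (show m ∈ S from hmin), one_mul, one_mul]
        exact evalTrop_anti x hm
      · simp
    · refine le_iInf fun μ => ?_
      rw [hp']
      split_ifs with hμ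
      · refine (iInf_le _ μ).trans ?_
        rw [hs', if_pos hμ.prop]
      · simp
  · intro μ hμ
    by_contra hcon
    apply hμ
    rw [MvPolynomial.coeff_coe, hc, if_neg fun h : μ ∈ S => hcon h.prop]

/-! ### Decision problems -/

/-- A decision problem, with instances `x : ι` presented to machines by their Gödel numbers
`code x`, is recursively enumerable: some semi-decision procedure is correct on all instances
(whatever it does on numbers that are not the code of an instance). -/
def ProblemRE {ι : Type} (code : ι → ℕ) (yes : ι → Prop) : Prop :=
  ∃ P : ℕ → Prop, REPred P ∧ ∀ x, P (code x) ↔ yes x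

/-- A decision problem is `Π⁰₁`-hard: every `Π⁰₁` set of natural numbers (that is, every set with
recursively enumerable complement) is many-one reducible to it by a computable function. -/
def ProblemPi01Hard {ι : Type} (code : ι → ℕ) (yes : ι → Prop) : Prop :=
  ∀ A : ℕ → Prop, REPred (fun n => ¬ A n) →
    ∃ f : ℕ → ι, Computable (fun n => code (f n)) ∧ ∀ n, A n ↔ yes (f n)

/-- The Gödel number of an instance: a number `d` and a closed term `M : Bool`. -/
def instanceCode {k : ℕ} (x : ℕ × Tm k [] Ty.bool) : ℕ := Nat.pair x.1 x.2.code

end PCFX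

end

/-!
Evaluating power series in the Boolean semiring, with the variables outside a set `ρ` set to zero,
collapses the weighted relational semantics to a semantics of sets of points, in which a term
without choices has its ordinary value. Primitive recursive functions are definable, and unbounded
search then gives, uniformly in `n`, a closed term `T` that converges to `i` if and only if `n` does
not belong to a given `Π⁰₁` set. The term `i ⊕_{X_j} ((1 - i) ⊕_{X_j} T)` has the series
`X_j + X̄_j² · ⟦T⟧_i` at `i`. If `⟦T⟧_i` has no monomial that avoids `X_j`, the tropical polynomial
`X_j` already defines its tropicalization, and the degree is `1`. Otherwise the tropicalization is
finite at the point where `X_j = ∞` and all other variables are `0`, which forces a monomial that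
avoids `X_j` into every representing polynomial, and the degree is at least `2`.
-/

namespace PCFX

/-! ### Boolean evaluation of power series -/

/-- The value of the power series `s` in the Boolean semiring, when exactly the variables in `ρ`
are true. It is both the shadow of the semantics that decides convergence and, by
`evalTrop_indicator_ne_zero`, the finiteness of a tropical series at points with coordinates in
`{0, ∞}`. -/
def BoolEval {V Q : Type} [Semiring Q] (s : MvPowerSeries V Q) (ρ : Set V) : Prop :=
  ∃ μ ∈ FPS.supp s, (μ.support : Set V) ⊆ ρ

section BoolEval

variable {V Q : Type} {ρ : Set V}

theorem boolEval_univ [Semiring Q] {s : MvPowerSeries V Q} :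
    BoolEval s Set.univ ↔ (FPS.supp s).Nonempty :=
  exists_congr fun _ => and_iff_left (Set.subset_univ _)

theorem boolEval_compl_singleton [Semiring Q] {s : MvPowerSeries V Q} {v : V} :
    BoolEval s {v}ᶜ ↔ ∃ μ ∈ FPS.supp s, μ v = 0 := by
  simp [BoolEval, Set.subset_compl_singleton_iff]

theorem not_boolEval_zero [Semiring Q] : ¬ BoolEval (0 : MvPowerSeries V Q) ρ := by
  rintro ⟨μ, hμ, -⟩
  exact hμ (map_zero _)

section Nontrivial

variable [Semiring Q] [Nontrivial Q]

theorem boolEval_one : BoolEval (1 : MvPowerSeries V Q) ρ :=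
  ⟨0, by simp [FPS.supp], by simp⟩

theorem supp_X (v : V) :
    FPS.supp (MvPowerSeries.X v : MvPowerSeries V Q) = {Finsupp.single v 1} := by
  classical
  ext μ
  simp [FPS.supp, MvPowerSeries.coeff_X]

theorem boolEval_X {v : V} : BoolEval (MvPowerSeries.X v : MvPowerSeries V Q) ρ ↔ v ∈ ρ := by
  simp [BoolEval, supp_X]

end Nontrivial

section CanonicallyOrdered

variable [Semiring Q] [PartialOrder Q] [CanonicallyOrderedAdd Q] {s t : MvPowerSeries V Q}

theorem supp_add : FPS.supp (s + t) = FPS.supp s ∪ FPS.supp t := by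
  ext μ
  simp only [FPS.supp, Set.mem_ofPred_eq, Set.mem_union, map_add, ne_eq, add_eq_zero,
    not_and_or]

theorem boolEval_add : BoolEval (s + t) ρ ↔ BoolEval s ρ ∨ BoolEval t ρ := by
  simp only [BoolEval, supp_add, Set.mem_union, or_and_right, exists_or]

variable [NoZeroDivisors Q]

open scoped Pointwise in
theorem supp_mul : FPS.supp (s * t) = FPS.supp s + FPS.supp t := by
  classical
  ext μ
  simp only [FPS.supp, Set.mem_add, Set.mem_ofPred_eq, MvPowerSeries.coeff_mul, ne_eq,
    Finset.sum_eq_zero_iff, Prod.forall, Finset.HasAntidiagonal.mem_antidiagonal, mul_eq_zero,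
    not_forall, not_or]
  grind

theorem boolEval_mul : BoolEval (s * t) ρ ↔ BoolEval s ρ ∧ BoolEval t ρ := by
  classical
  have support_add (μ ν : V →₀ ℕ) : (μ + ν).support = μ.support ∪ ν.support := by
    ext v
    simp [imp_iff_not_or]
  simp only [BoolEval, supp_mul, Set.mem_add]
  constructor
  · rintro ⟨_, ⟨μ, hμ, ν, hν, rfl⟩, hρ⟩
    rw [support_add, Finset.coe_union, Set.union_subset_iff] at hρ
    exact ⟨⟨μ, hμ, hρ.1⟩, ν, hν, hρ.2⟩
  · rintro ⟨⟨μ, hμ, hμρ⟩, ν, hν, hνρ⟩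
    refine ⟨μ + ν, ⟨μ, hμ, ν, hν, rfl⟩, ?_⟩
    rw [support_add, Finset.coe_union]
    exact Set.union_subset hμρ hνρ

end CanonicallyOrdered

section CommSemiring

variable [CommSemiring Q] [PartialOrder Q] [CanonicallyOrderedAdd Q] [NoZeroDivisors Q]
  [Nontrivial Q]

theorem boolEval_prod {ι : Type*} (t : Finset ι) (f : ι → MvPowerSeries V Q) :
    BoolEval (∏ j ∈ t, f j) ρ ↔ ∀ j ∈ t, BoolEval (f j) ρ := by
  induction t using Finset.cons_induction with
  | empty => simp [boolEval_one]
  | cons a t ha ih => rw [Finset.prod_cons, boolEval_mul, ih, Finset.forall_mem_cons]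

theorem boolEval_pow {s : MvPowerSeries V Q} {n : ℕ} (hn : n ≠ 0) :
    BoolEval (s ^ n) ρ ↔ BoolEval s ρ := by
  have : Nonempty (Fin n) := Fin.pos_iff_nonempty.1 (Nat.pos_of_ne_zero hn)
  rw [← Fin.prod_const, boolEval_prod]
  simp

end CommSemiring

theorem supp_infSum {ι : Type} (f : ι → FPS V) :
    FPS.supp (FPS.infSum f) = ⋃ j, FPS.supp (f j) := by
  ext μ
  have hcoeff : MvPowerSeries.coeff μ (FPS.infSum f) =
    ⨆ s : Finset ι, ∑ j ∈ s, MvPowerSeries.coeff μ (f j) := rfl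
  simp only [FPS.supp, Set.mem_ofPred_eq, Set.mem_iUnion, hcoeff, ne_eq, ENat.iSup_eq_zero,
    Finset.sum_eq_zero_iff]
  exact ⟨fun h => by_contra fun h' => h (by simp_all), fun ⟨j, hj⟩ h => hj (h {j} j (by simp))⟩

theorem supp_sup (f : ℕ → FPS V) : FPS.supp (FPS.sup f) = ⋃ n, FPS.supp (f n) := by
  ext μ
  have hcoeff : MvPowerSeries.coeff μ (FPS.sup f) = ⨆ n, MvPowerSeries.coeff μ (f n) := rfl
  simp [FPS.supp, hcoeff]

theorem boolEval_infSum {ι : Type} {f : ι → FPS V} :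
    BoolEval (FPS.infSum f) ρ ↔ ∃ j, BoolEval (f j) ρ := by
  simp only [BoolEval, supp_infSum, Set.mem_iUnion, ← exists_and_right]
  exact exists_comm

theorem boolEval_sup {f : ℕ → FPS V} : BoolEval (FPS.sup f) ρ ↔ ∃ n, BoolEval (f n) ρ := by
  simp only [BoolEval, supp_sup, Set.mem_iUnion, ← exists_and_right]
  exact exists_comm

end BoolEval

/-! ### The tropical degree of a power series -/

section TropicalDegree

variable {V : Type}

open Classical in
theorem prod_indicator_one_pow {R : Type*} [CommMonoidWithZero R] (μ : V →₀ ℕ) (ρ : Set V) :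
    (μ.prod fun a n => ρ.indicator (1 : V → R) a ^ n) =
      if (μ.support : Set V) ⊆ ρ then 1 else 0 := by
  split_ifs with h
  · refine Finset.prod_eq_one fun a ha => ?_
    simp only [Set.indicator_of_mem (h ha), Pi.one_apply, one_pow]
  · obtain ⟨a, ha, haρ⟩ := Set.not_subset.1 h
    refine Finset.prod_eq_zero ha ?_
    simp only [Set.indicator_of_notMem haρ, zero_pow (Finsupp.mem_support_iff.1 ha)]

theorem evalTrop_indicator_ne_zero {s : MvPowerSeries V Trop} {ρ : Set V} :
    evalTrop s (ρ.indicator 1) ≠ 0 ↔ BoolEval s ρ := by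
  classical
  have hz (y : Trop) : Tropical.untrop y = ⊤ ↔ y = 0 :=
    Tropical.untrop_injective.eq_iff (b := (0 : Trop))
  rw [evalTrop, Ne, ← hz, Tropical.untrop_trop, iInf_eq_top, not_forall]
  simp only [hz, prod_indicator_one_pow, mul_ite, mul_one, mul_zero, ite_eq_right_iff,
    Classical.not_imp, BoolEval]
  exact exists_congr fun _ => and_comm

instance : Nontrivial Trop :=
  ⟨0, 1, fun h => ENNReal.top_ne_zero (congrArg Tropical.untrop h)⟩

theorem supp_tropSeries (s : FPS V) : FPS.supp (tropSeries s) = FPS.supp s := by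
  classical
  ext μ
  change (if μ ∈ FPS.supp s then (1 : Trop) else 0) ≠ 0 ↔ _
  simp

theorem evalTrop_eq_iInf_supp {s : MvPowerSeries V Trop}
    (hs : ∀ μ ∈ FPS.supp s, MvPowerSeries.coeff μ s = 1) (x : V → Trop) :
    evalTrop s x =
      Tropical.trop (⨅ μ ∈ FPS.supp s, Tropical.untrop (μ.prod fun a n => x a ^ n)) := by
  refine congrArg Tropical.trop (iInf_congr fun μ => ?_)
  by_cases hμ : μ ∈ FPS.supp s
  · rw [hs μ hμ, one_mul, iInf_pos hμ]
  · rw [not_not.1 hμ, zero_mul, iInf_neg hμ, Tropical.untrop_zero]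

theorem evalTrop_eq_evalTrop_tropSeries {p : MvPowerSeries V Trop} {s : FPS V}
    (hp : ∀ μ ∈ FPS.supp p, MvPowerSeries.coeff μ p = 1) (hps : FPS.supp p ⊆ FPS.supp s)
    (hs : ∀ μ ∈ FPS.supp s, ∃ ν ∈ FPS.supp p, ν ≤ μ) :
    evalTrop p = evalTrop (tropSeries s) := by
  classical
  have hone : ∀ μ ∈ FPS.supp (tropSeries s), MvPowerSeries.coeff μ (tropSeries s) = 1 :=
    fun μ hμ => if_pos (supp_tropSeries s ▸ hμ)
  ext x
  rw [evalTrop_eq_iInf_supp hp, evalTrop_eq_iInf_supp hone, supp_tropSeries]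
  refine congrArg Tropical.trop (le_antisymm ?_ (biInf_mono hps))
  refine le_iInf₂ fun μ hμ => ?_
  obtain ⟨ν, hν, hνμ⟩ := hs μ hμ
  exact (iInf₂_le ν hν).trans (evalTrop_anti x hνμ)

theorem le_sInf_degreeSet [Finite V] {s : FPS V} {ρ : Set V} {n : ℕ} (h : BoolEval s ρ)
    (hn : ∀ μ ∈ FPS.supp s, (μ.support : Set V) ⊆ ρ → n ≤ μ.degree) :
    n ≤ sInf (degreeSet s) := by
  refine le_csInf (degreeSet_nonempty s) ?_
  rintro _ ⟨p, -, hps, hsupp, rfl⟩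
  have hp : BoolEval (p : MvPowerSeries V Trop) ρ := by
    rw [← evalTrop_indicator_ne_zero, hps, evalTrop_indicator_ne_zero]
    simpa only [BoolEval, supp_tropSeries] using h
  obtain ⟨μ, hμ, hμρ⟩ := hp
  refine (hn μ (hsupp hμ) hμρ).trans (MvPolynomial.le_totalDegree ?_)
  rwa [MvPolynomial.mem_support_iff, ← MvPolynomial.coeff_coe]

theorem sInf_degreeSet_eq_one [Finite V] {s : FPS V} {v : V}
    (hv : Finsupp.single v 1 ∈ FPS.supp s) (hs : ¬ BoolEval s {v}ᶜ) :
    sInf (degreeSet s) = 1 := by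
  have hpos : ∀ μ ∈ FPS.supp s, μ v ≠ 0 := by
    simpa [boolEval_compl_singleton] using hs
  refine le_antisymm (Nat.sInf_le ?_) (le_sInf_degreeSet (boolEval_univ.2 ⟨_, hv⟩) ?_)
  · classical
    refine ⟨MvPolynomial.X v, fun μ => ?_, evalTrop_eq_evalTrop_tropSeries ?_ ?_ ?_, ?_,
      MvPolynomial.totalDegree_X v⟩
    · rw [MvPolynomial.coeff_X]
      split_ifs <;> simp
    · simp [supp_X]
    · simpa [supp_X] using hv
    · simpa [supp_X, Nat.one_le_iff_ne_zero] using hpos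
    · simpa [supp_X] using hv
  · exact fun μ hμ _ => (Nat.one_le_iff_ne_zero.2 (hpos μ hμ)).trans (Finsupp.le_degree v μ)

end TropicalDegree

/-! ### The Boolean shadow of the relational semantics -/

/-- Application in the relational semantics with Boolean coefficients, as a function of the set of
points of the argument. -/
def setApp {A B : Ty} (F : Set (Pt (A.arr B))) : Set (Pt A) →o Set (Pt B) where
  toFun G := {b | ∃ m : Pt A →₀ ℕ, (m, b) ∈ F ∧ (m.support : Set (Pt A)) ⊆ G}
  monotone' _ _ hG _ := fun ⟨m, hm, hmG⟩ => ⟨m, hm, hmG.trans hG⟩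

/-- The environment that extends `ρ` by the set of points `G` for a new variable. -/
def envCons {k : ℕ} {Γ : List Ty} {A : Ty} (G : Set (Pt A)) (ρ : Set (FVar k Γ)) :
    Set (FVar k (A :: Γ)) :=
  {v | Sum.elim (· ∈ G) (· ∈ ρ) v}

/-- The set of points of a term, when exactly the formal variables in `ρ` are true. -/
def Tm.points {k : ℕ} {Γ : List Ty} {A : Ty} (M : Tm k Γ A) (ρ : Set (FVar k Γ)) : Set (Pt A) :=
  {a | BoolEval (M.interp a) ρ}

/-- The set of points of a numerical term with value `n`. -/
def valueSet (n : ℕ) : Set (Pt .nat) :=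
  ({n} : Set ℕ)

/-- The numerical term `M` converges to `n` and to nothing else, when exactly the formal variables
in `ρ` are true. -/
def Tm.HasValue {k : ℕ} {Γ : List Ty} (M : Tm k Γ .nat) (ρ : Set (FVar k Γ)) (n : ℕ) : Prop :=
  M.points ρ = valueSet n

theorem support_sumElim_subset {α β : Type*} {m : α →₀ ℕ} {ν : β →₀ ℕ} {G : Set α} {ρ : Set β} :
    ((Finsupp.sumElim m ν).support : Set (α ⊕ β)) ⊆ {v | Sum.elim (· ∈ G) (· ∈ ρ) v} ↔
      (m.support : Set α) ⊆ G ∧ (ν.support : Set β) ⊆ ρ := by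
  simp [Set.subset_def]

section SetApp

variable {A B : Ty}

theorem mem_setApp_sSup {𝓕 : Set (Set (Pt (A.arr B)))} {G : Set (Pt A)} {b : Pt B} :
    b ∈ setApp (sSup 𝓕) G ↔ ∃ F ∈ 𝓕, b ∈ setApp F G := by
  constructor
  · rintro ⟨m, ⟨F, hF, hm⟩, hG⟩
    exact ⟨F, hF, m, hm, hG⟩
  · rintro ⟨F, hF, m, hm, hG⟩
    exact ⟨m, ⟨F, hF, hm⟩, hG⟩

theorem scottContinuous_setApp (F : Set (Pt (A.arr B))) : ScottContinuous (setApp F) := by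
  rintro 𝓖 hne hdir G hG
  obtain rfl : G = sSup 𝓖 := hG.unique (isLUB_sSup 𝓖)
  refine ⟨(setApp F).monotone.mem_upperBounds_image hG.1, fun H hH b => ?_⟩
  rintro ⟨m, hm, hmG⟩
  obtain ⟨G, hG, hmG⟩ :=
    hdir.exists_mem_subset_of_finite_of_subset_sUnion hne m.support.finite_toSet hmG
  exact hH ⟨G, hG, rfl⟩ ⟨m, hm, hmG⟩

theorem boolEval_applySeries {V : Type} {f : Pt (A.arr B) → FPS V} {g : Pt A → FPS V} {b : Pt B}
    {ρ : Set V} :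
    BoolEval (applySeries f g b) ρ ↔
      b ∈ setApp {p | BoolEval (f p) ρ} {a | BoolEval (g a) ρ} := by
  rw [applySeries, boolEval_infSum]
  refine exists_congr fun m => ?_
  rw [boolEval_mul, Finsupp.prod, boolEval_prod]
  refine and_congr Iff.rfl (forall₂_congr fun a ha => ?_)
  exact boolEval_pow (Finsupp.mem_support_iff.1 ha)

theorem setOf_boolEval_fixIter {V : Type} (f : Pt (A.arr A) → FPS V) (ρ : Set V) (n : ℕ) :
    {a | BoolEval (fixIter f n a) ρ} = (setApp {p | BoolEval (f p) ρ})^[n] ⊥ := by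
  induction n with
  | zero => exact Set.eq_empty_of_forall_notMem fun _ => not_boolEval_zero
  | succ n ih =>
    rw [Function.iterate_succ_apply', ← ih]
    exact Set.ext fun _ => boolEval_applySeries

end SetApp

section Points

variable {k : ℕ} {Γ : List Ty} {A B : Ty} {ρ : Set (FVar k Γ)}

theorem points_var_here {G : Set (Pt A)} :
    (Tm.var Var.here).points (envCons G ρ) = G :=
  Set.ext fun _ => boolEval_X

theorem points_var_there {G : Set (Pt B)} {x : Var Γ A} :
    (Tm.var x.there).points (envCons G ρ) = (Tm.var x).points ρ :=
  Set.ext fun a => boolEval_X.trans (boolEval_X (v := x.point k a)).symm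

theorem hasValue_var_here {n : ℕ} :
    (Tm.var Var.here).HasValue (envCons (valueSet n) ρ) n :=
  points_var_here

theorem hasValue_zero : Tm.zero.HasValue ρ 0 := by
  refine Set.ext fun n : ℕ => ?_
  change BoolEval (if n = 0 then 1 else 0) ρ ↔ n = 0
  split_ifs with h <;> simp [h, boolEval_one, not_boolEval_zero]

theorem points_succ {M : Tm k Γ .nat} : M.succ.points ρ = Nat.succ '' M.points ρ := by
  refine Set.ext fun n : ℕ => ?_
  cases n with
  | zero => exact iff_of_false not_boolEval_zero fun ⟨_, _, h⟩ => Nat.succ_ne_zero _ h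
  | succ n => exact (Nat.succ_injective.mem_set_image (s := M.points ρ)).symm

theorem points_pred {M : Tm k Γ .nat} : M.pred.points ρ = Nat.pred '' M.points ρ := by
  refine Set.ext fun n : ℕ => ?_
  cases n with
  | zero =>
    refine (boolEval_add (s := M.interp (0 : ℕ)) (t := M.interp (1 : ℕ))).trans ⟨?_, ?_⟩
    · exact fun h => h.elim (fun h => ⟨(0 : ℕ), h, rfl⟩) fun h => ⟨(1 : ℕ), h, rfl⟩
    · rintro ⟨m, hm, hm0⟩
      obtain rfl | rfl := Nat.le_one_iff_eq_zero_or_eq_one.1 (Nat.sub_eq_zero_iff_le.1 hm0)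
      exacts [.inl hm, .inr hm]
  | succ n =>
    refine ⟨fun h => ⟨(n + 2 : ℕ), h, rfl⟩, ?_⟩
    rintro ⟨m, hm, hmn⟩
    obtain rfl : m = (n + 2 : ℕ) := by simp at hmn; omega
    exact hm

theorem mem_points_ifz {M : Tm k Γ .nat} {N P : Tm k Γ A} {a : Pt A} :
    a ∈ (M.ifz N P).points ρ ↔ ((0 : ℕ) ∈ M.points ρ ∧ a ∈ N.points ρ) ∨
      (∃ n : ℕ, n + 1 ∈ M.points ρ) ∧ a ∈ P.points ρ := by
  refine boolEval_add.trans (or_congr boolEval_mul (boolEval_infSum.trans ?_))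
  exact (exists_congr fun _ => boolEval_mul).trans exists_and_right

section HasValue

variable {M : Tm k Γ .nat} {n : ℕ} (hM : M.HasValue ρ n)

include hM

theorem Tm.HasValue.mem_points_iff {m : ℕ} : m ∈ M.points ρ ↔ m = n :=
  Set.ext_iff.1 hM m

theorem Tm.HasValue.succ : M.succ.HasValue ρ (n + 1) :=
  (points_succ.trans (congrArg (Nat.succ '' ·) hM)).trans Set.image_singleton

theorem Tm.HasValue.pred : M.pred.HasValue ρ (n - 1) :=
  (points_pred.trans (congrArg (Nat.pred '' ·) hM)).trans Set.image_singleton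

theorem Tm.HasValue.points_ifz {N P : Tm k Γ A} :
    (M.ifz N P).points ρ = if n = 0 then N.points ρ else P.points ρ := by
  ext a
  simp only [mem_points_ifz, hM.mem_points_iff]
  cases n <;> simp

end HasValue

theorem points_app {M : Tm k Γ (A.arr B)} {N : Tm k Γ A} :
    (M.app N).points ρ = setApp (M.points ρ) (N.points ρ) :=
  Set.ext fun _ => boolEval_applySeries

theorem setApp_points_lam {M : Tm k (A :: Γ) B} {G : Set (Pt A)} :
    setApp (M.lam.points ρ) G = M.points (envCons G ρ) := by
  ext b
  constructor
  · rintro ⟨m, ⟨ν, hν, hνρ⟩, hm⟩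
    exact ⟨Finsupp.sumElim m ν, hν, support_sumElim_subset.2 ⟨hm, hνρ⟩⟩
  · rintro ⟨μ, hμ, hμG⟩
    obtain ⟨⟨m, ν⟩, rfl⟩ := Finsupp.sumFinsuppEquivProdFinsupp.symm.surjective μ
    obtain ⟨hm, hνρ⟩ := support_sumElim_subset.1 hμG
    exact ⟨m, ⟨ν, hμ, hνρ⟩, hm⟩

theorem Tm.HasValue.points_app_lam {M : Tm k (.nat :: Γ) A} {N : Tm k Γ .nat} {n : ℕ}
    (hN : N.HasValue ρ n) :
    (M.lam.app N).points ρ = M.points (envCons (valueSet n) ρ) := by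
  rw [points_app, setApp_points_lam]
  exact congrArg (fun G => M.points (envCons G ρ)) hN

theorem points_fix {M : Tm k Γ (A.arr A)} : M.fix.points ρ = (setApp (M.points ρ)).lfp := by
  rw [fixedPoints.lfp_eq_sSup_iterate _ (scottContinuous_setApp _).ωScottContinuous]
  ext a
  rw [Set.iSup_eq_iUnion, Set.mem_iUnion]
  refine boolEval_sup.trans (exists_congr fun n => ?_)
  exact Set.ext_iff.1 (setOf_boolEval_fixIter M.interp ρ n) a

theorem setApp_points_fix_lam_lam {M : Tm k (A :: A.arr B :: Γ) B} {G : Set (Pt A)} :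
    setApp (M.lam.lam.fix.points ρ) G =
      M.points (envCons G (envCons (M.lam.lam.fix.points ρ) ρ)) := by
  conv_lhs => rw [points_fix, ← OrderHom.map_lfp, ← points_fix]
  rw [setApp_points_lam, setApp_points_lam]

end Points

/-! ### Definability of the primitive recursive functions -/

section Definable

variable {k : ℕ} {Γ : List Ty} {ι : Type} {ρ : Set (FVar k Γ)}

/-- The environment `ρ` assigns the numbers `v` to the variables `xs`. -/
def Assigns (ρ : Set (FVar k Γ)) (xs : ι → Var Γ .nat) (v : ι → ℕ) : Prop :=
  ∀ j, (Tm.var (xs j)).HasValue ρ (v j)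

/-- The function `f` is computed by a term in which numerical variables stand for the arguments.
Any variables of any context may be chosen for this purpose, so that no weakening of terms is
needed. -/
def Definable (k : ℕ) (f : (ι → ℕ) → ℕ) : Prop :=
  ∀ (Γ : List Ty) (xs : ι → Var Γ .nat), ∃ M : Tm k Γ .nat, ∀ ρ v, Assigns ρ xs v →
    M.HasValue ρ (f v)

theorem Assigns.there {A : Ty} {xs : ι → Var Γ .nat} {v : ι → ℕ} (h : Assigns ρ xs v)
    (G : Set (Pt A)) : Assigns (envCons G ρ) (fun j => (xs j).there) v :=
  fun j => points_var_there.trans (h j)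

theorem Assigns.cons {n m : ℕ} {x : Var Γ .nat} {xs : Fin n → Var Γ .nat} {v : Fin n → ℕ}
    (hx : (Tm.var x).HasValue ρ m) (h : Assigns ρ xs v) :
    Assigns ρ (Fin.cons x xs : Fin (n + 1) → Var Γ .nat) (Fin.cons m v : Fin (n + 1) → ℕ) :=
  Fin.cases hx h

theorem Definable.subst {n : ℕ} {f : (ι ⊕ Fin n → ℕ) → ℕ} {g : Fin n → (ι → ℕ) → ℕ}
    (hf : Definable k f) (hg : ∀ j, Definable k (g j)) :
    Definable k fun v => f (Sum.elim v fun j => g j v) := by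
  induction n with
  | zero =>
    intro Γ xs
    obtain ⟨M, hM⟩ := hf Γ (Sum.elim xs Fin.elim0)
    exact ⟨M, fun ρ v hv => hM ρ _ (Sum.rec hv fun j => j.elim0)⟩
  | succ n ih =>
    have hcons (v : ι → ℕ) : (Fin.cons (g 0 v) fun j => g j.succ v : Fin (n + 1) → ℕ) =
        fun j => g j v := Fin.cons_self_tail fun j => g j v
    simp only [← hcons]
    refine ih (f := fun w => f (Sum.elim (w ∘ Sum.inl) (Fin.cons (g 0 (w ∘ Sum.inl))
      (w ∘ Sum.inr)))) ?_ fun j => hg j.succ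
    intro Γ xs
    obtain ⟨G, hG⟩ := hg 0 Γ (xs ∘ Sum.inl)
    obtain ⟨M, hM⟩ := hf (.nat :: Γ) (Sum.elim (fun j => (xs (.inl j)).there)
      (Fin.cons Var.here fun j => (xs (.inr j)).there))
    refine ⟨M.lam.app G, fun ρ w hw => ?_⟩
    have hwl : Assigns ρ (xs ∘ Sum.inl) (w ∘ Sum.inl) := fun j => hw (.inl j)
    have hwr : Assigns ρ (xs ∘ Sum.inr) (w ∘ Sum.inr) := fun j => hw (.inr j)
    exact (hG ρ _ hwl).points_app_lam.trans
      (hM _ _ (Sum.rec (hwl.there _) (Assigns.cons hasValue_var_here (hwr.there _))))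

theorem Definable.comp {n : ℕ} {f : (Fin n → ℕ) → ℕ} {g : Fin n → (ι → ℕ) → ℕ}
    (hf : Definable k f) (hg : ∀ j, Definable k (g j)) :
    Definable k fun v => f fun j => g j v := by
  refine Definable.subst (f := fun w => f (w ∘ Sum.inr)) (fun Γ xs => ?_) hg
  obtain ⟨M, hM⟩ := hf Γ (xs ∘ Sum.inr)
  exact ⟨M, fun ρ w hw => hM ρ _ fun j => hw (.inr j)⟩

/-- The function defined by primitive recursion from the base case `F` and the step `G`. In `G`,
the first two variables are the result of the recursive call and its argument. -/
def natRecTm (F : Tm k (.nat :: .arr .nat .nat :: Γ) .nat)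
    (G : Tm k (.nat :: .nat :: .nat :: .arr .nat .nat :: Γ) .nat) : Tm k Γ (.arr .nat .nat) :=
  .fix <| .lam <| .lam <| .ifz (.var .here) F <|
    .app (.lam (.app (.lam G) (.app (.var (.there (.there .here))) (.var .here))))
      (.pred (.var .here))

theorem setApp_points_natRecTm {F : Tm k (.nat :: .arr .nat .nat :: Γ) .nat}
    {G : Tm k (.nat :: .nat :: .nat :: .arr .nat .nat :: Γ) .nat} {r : ℕ → ℕ}
    (hF : ∀ R, F.HasValue (envCons (valueSet 0) (envCons R ρ)) (r 0))
    (hG : ∀ R (n : ℕ), G.HasValue (envCons (valueSet (r n))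
      (envCons (valueSet n) (envCons (valueSet (n + 1)) (envCons R ρ))))
      (r (n + 1))) (n : ℕ) :
    setApp ((natRecTm F G).points ρ) (valueSet n) = valueSet (r n) := by
  induction n with
  | zero =>
    rw [natRecTm, setApp_points_fix_lam_lam, hasValue_var_here.points_ifz, if_pos rfl]
    exact hF _
  | succ n ih =>
    rw [natRecTm, setApp_points_fix_lam_lam, hasValue_var_here.points_ifz,
      if_neg n.succ_ne_zero, hasValue_var_here.pred.points_app_lam]
    refine Eq.trans (Tm.HasValue.points_app_lam ?_) (hG _ n)
    rw [Tm.HasValue, points_app, points_var_there, points_var_there, points_var_here,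
      points_var_here]
    exact ih

theorem Definable.prec {n : ℕ} {f : (Fin n → ℕ) → ℕ} {g : (Fin (n + 2) → ℕ) → ℕ}
    (hf : Definable k f) (hg : Definable k g) :
    Definable k fun v : Fin (n + 1) → ℕ =>
      (v 0).rec (f (Fin.tail v)) fun m r => g (Fin.cons m (Fin.cons r (Fin.tail v))) := by
  intro Γ xs
  obtain ⟨F, hF⟩ := hf (.nat :: .arr .nat .nat :: Γ) fun j => (xs j.succ).there.there
  obtain ⟨G, hG⟩ := hg (.nat :: .nat :: .nat :: .arr .nat .nat :: Γ) (Fin.cons (.there .here)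
    (Fin.cons .here fun j => (xs j.succ).there.there.there.there))
  refine ⟨(natRecTm F G).app (.var (xs 0)), fun ρ v hv => ?_⟩
  let r (m : ℕ) : ℕ := m.rec (f (Fin.tail v)) fun m r => g (Fin.cons m (Fin.cons r (Fin.tail v)))
  have htail : Assigns ρ (fun j => xs j.succ) (Fin.tail v) := fun j => hv j.succ
  refine (points_app.trans (congrArg _ (hv 0))).trans
    (setApp_points_natRecTm (r := r) (fun R => ?_) (fun R m => ?_) (v 0))
  · exact hF _ _ ((htail.there _).there _)
  · exact hG _ _ (.cons (points_var_there.trans hasValue_var_here)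
      (.cons hasValue_var_here ((((htail.there _).there _).there _).there _)))

theorem definable_of_primrec' {n : ℕ} {f : List.Vector ℕ n → ℕ} (hf : Nat.Primrec' f) :
    Definable k fun v => f (List.Vector.ofFn v) := by
  induction hf with
  | zero => exact fun Γ _ => ⟨.zero, fun _ _ _ => hasValue_zero⟩
  | succ => exact fun Γ xs => ⟨.succ (.var (xs 0)), fun ρ v hv => (hv 0).succ⟩
  | get j =>
    refine fun Γ xs => ⟨.var (xs j), fun ρ v hv => ?_⟩
    simpa using hv j
  | comp g _ _ hf hg => exact hf.comp hg
  | prec _ _ hf hg => exact hf.prec hg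

theorem definable_of_primrec₂ {f : ℕ → ℕ → ℕ} (hf : Primrec₂ f) :
    Definable k fun v : Fin 2 → ℕ => f (v 0) (v 1) := by
  simpa using definable_of_primrec' (k := k) (Nat.Primrec'.prim_iff₂.2 hf)

end Definable

/-! ### Semi-decision by unbounded search -/

theorem exists_primrec₂_of_rePred {p : ℕ → Prop} (hp : REPred p) :
    ∃ f : ℕ → ℕ → ℕ, Primrec₂ f ∧ ∀ n, p n ↔ ∃ t, f t n = 0 := by
  obtain ⟨c, hc⟩ := Nat.Partrec.Code.exists_code.1 hp
  have hdom (n : ℕ) : p n ↔ (c.eval n).Dom := by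
    simp [hc, Part.assert]
  refine ⟨fun t n => Option.casesOn (c.evaln t n) 1 fun _ => 0, ?_, fun n => ?_⟩
  · refine Primrec.option_casesOn (o := fun q : ℕ × ℕ => c.evaln q.1 q.2) ?_ (.const 1)
      (Primrec.const 0).to₂
    exact Nat.Partrec.Code.primrec_evaln.comp ((Primrec.fst.pair (.const c)).pair .snd)
  · simp only [hdom, Part.dom_iff_mem, Nat.Partrec.Code.evaln_complete]
    rw [exists_comm]
    refine exists_congr fun t => ?_
    cases c.evaln t n <;> simp

section Search

variable {k : ℕ} {Γ : List Ty} {B : Ty} {ρ : Set (FVar k Γ)}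
  {F : Tm k (.nat :: .arr .nat B :: Γ) .nat} {N : Tm k (.nat :: .arr .nat B :: Γ) B}

/-- The search loop that evaluates `F` at `t`, `t + 1`, … and continues as `N` at the first zero. -/
def searchTm (F : Tm k (.nat :: .arr .nat B :: Γ) .nat) (N : Tm k (.nat :: .arr .nat B :: Γ) B) :
    Tm k Γ (.arr .nat B) :=
  .fix <| .lam <| .lam <| .ifz F N <| .app (.var (.there .here)) (.succ (.var .here))

theorem points_search_body {R : Set (Pt (.arr .nat B))} {t n : ℕ}
    (hF : F.HasValue (envCons (valueSet t) (envCons R ρ)) n) :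
    (F.ifz N (.app (.var (.there .here)) (.succ (.var .here)))).points
      (envCons (valueSet t) (envCons R ρ)) =
        if n = 0 then N.points (envCons (valueSet t) (envCons R ρ))
        else setApp R (valueSet (t + 1)) := by
  rw [hF.points_ifz, points_app, points_var_there, points_var_here, hasValue_var_here.succ]

theorem mem_setApp_points_searchTm {f : ℕ → ℕ} {b : Pt B}
    (hF : ∀ R t, F.HasValue (envCons (valueSet t) (envCons R ρ)) (f t))
    (hN : ∀ R t, b ∈ N.points (envCons (valueSet t) (envCons R ρ))) {t : ℕ} :
    b ∈ setApp ((searchTm F N).points ρ) (valueSet t) ↔ ∃ s ≥ t, f s = 0 := by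
  constructor
  · revert t
    rw [searchTm, points_fix]
    refine OrderHom.lfp_induction _
      (p := fun R => ∀ {t}, b ∈ setApp R (valueSet t) → ∃ s ≥ t, f s = 0) ?_ ?_
    · intro R hR _ t hb
      rw [setApp_points_lam, setApp_points_lam, points_search_body (hF R t)] at hb
      split_ifs at hb with ht
      · exact ⟨t, le_rfl, ht⟩
      · obtain ⟨s, hs, hfs⟩ := hR hb
        exact ⟨s, t.le_succ.trans hs, hfs⟩
    · intro 𝓡 h𝓡 t hb
      obtain ⟨R, hR, hbR⟩ := mem_setApp_sSup.1 hb
      exact h𝓡 R hR hbR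
  · rintro ⟨s, hs, hfs⟩
    induction hs using Nat.decreasingInduction with
    | self =>
      rw [searchTm, setApp_points_fix_lam_lam, points_search_body (hF _ s), if_pos hfs]
      exact hN _ s
    | of_succ t _ hb =>
      rw [searchTm, setApp_points_fix_lam_lam, points_search_body (hF _ t)]
      split_ifs
      exacts [hN _ t, hb]

end Search

section SemiDecision

variable {k : ℕ}

/-- The Boolean constant `i`. -/
def boolTm (k : ℕ) (Γ : List Ty) (i : Fin 2) : Tm k Γ .bool :=
  if i = 0 then .bool0 else .bool1

theorem interp_boolTm {Γ : List Ty} (i j : Fin 2) :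
    (boolTm k Γ i).interp j = if j = i then 1 else 0 := by
  fin_cases i <;> rfl

theorem boolEval_interp_boolTm {Γ : List Ty} {ρ : Set (FVar k Γ)} {i : Fin 2} :
    BoolEval ((boolTm k Γ i).interp i) ρ := by
  rw [interp_boolTm, if_pos rfl]
  exact boolEval_one

/-- The numeral `n`. -/
def numeral (k : ℕ) (Γ : List Ty) : ℕ → Tm k Γ .nat
  | 0 => .zero
  | n + 1 => .succ (numeral k Γ n)

theorem hasValue_numeral {Γ : List Ty} {ρ : Set (FVar k Γ)} (n : ℕ) :
    (numeral k Γ n).HasValue ρ n := by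
  induction n with
  | zero => exact hasValue_zero
  | succ n ih => exact ih.succ

theorem primrec_natPair_const {g : ℕ → ℕ} (c : ℕ) (hg : Primrec g) :
    Primrec fun n => Nat.pair c (g n) :=
  Primrec₂.natPair.comp (.const c) hg

theorem primrec_numeral_code (Γ : List Ty) : Primrec fun n => (numeral k Γ n).code := by
  refine (Primrec.nat_rec₁ (Nat.pair 0 0) (f := fun _ c => Nat.pair 1 c)
    ((primrec_natPair_const 1 .id).comp .snd).to₂).of_eq fun n => ?_
  induction n with
  | zero => rfl
  | succ n ih => exact congrArg (Nat.pair 1) ih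

theorem exists_boolEval_interp_app_numeral_iff {p : ℕ → Prop} (hp : REPred p) (i : Fin 2) :
    ∃ U : Tm k [] (.arr .nat .bool), ∀ (ρ : Set (FVar k [])) n,
      BoolEval ((U.app (numeral k [] n)).interp i) ρ ↔ p n := by
  obtain ⟨f, hf, hpf⟩ := exists_primrec₂_of_rePred hp
  obtain ⟨F, hF⟩ := definable_of_primrec₂ hf [.nat, .arr .nat .bool, .nat]
    ![.here, .there (.there .here)]
  let search : Tm k [.nat] (.arr .nat .bool) := searchTm F (boolTm k _ i)
  refine ⟨.lam (search.app .zero), fun ρ n => ?_⟩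
  have hFn (R : Set (Pt (.arr .nat .bool))) (t : ℕ) :
      F.HasValue (envCons (valueSet t) (envCons R (envCons (valueSet n) ρ))) (f t n) := by
    refine hF _ ![t, n] (Fin.cases hasValue_var_here (Fin.cases ?_ fun j => j.elim0))
    exact (points_var_there.trans points_var_there).trans hasValue_var_here
  have hpoints : ((search.app .zero).lam.app (numeral k [] n)).points ρ =
      setApp (search.points (envCons (valueSet n) ρ)) (valueSet 0) := by
    rw [(hasValue_numeral n).points_app_lam, points_app, hasValue_zero]
  refine (Set.ext_iff.1 hpoints i).trans ?_
  rw [mem_setApp_points_searchTm hFn fun _ _ => boolEval_interp_boolTm, hpf]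
  simp

theorem problemPi01Hard_not_boolEval_series (ρ : Set (Param k)) (i : Fin 2) :
    ProblemPi01Hard Tm.code fun T : Tm k [] .bool => ¬ BoolEval (T.series i) ρ := by
  intro A hA
  obtain ⟨U, hU⟩ := exists_boolEval_interp_app_numeral_iff (k := k) hA i
  refine ⟨fun n => U.app (numeral k [] n), Primrec.to_comp ?_, fun n => ?_⟩
  · exact primrec_natPair_const _ <| primrec_natPair_const _ <| primrec_natPair_const _ <|
      primrec_numeral_code []
  · exact not_not.symm.trans (hU ρ n).not.symm

end SemiDecision

/-! ### The reduction -/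

theorem ProblemPi01Hard.of_reduction {ι κ : Type} {code : ι → ℕ} {code' : κ → ℕ}
    {yes : ι → Prop} {yes' : κ → Prop} (hard : ProblemPi01Hard code yes) {g : ι → κ} {h : ℕ → ℕ}
    (hh : Computable h) (hcode : ∀ x, code' (g x) = h (code x))
    (hyes : ∀ x, yes x ↔ yes' (g x)) : ProblemPi01Hard code' yes' := by
  intro A hA
  obtain ⟨f, hf, hAf⟩ := hard A hA
  refine ⟨g ∘ f, (hh.comp hf).of_eq fun n => (hcode (f n)).symm, fun n => ?_⟩
  exact (hAf n).trans (hyes (f n))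

theorem ProblemPi01Hard.not_problemRE {ι : Type} {code : ι → ℕ} {yes : ι → Prop}
    (h : ProblemPi01Hard code yes) : ¬ ProblemRE code yes := by
  rintro ⟨P, hP, hPyes⟩
  let halts (n : ℕ) : Prop := (Nat.Partrec.Code.eval (Denumerable.ofNat _ n) 0).Dom
  have hre : REPred halts :=
    (ComputablePred.halting_problem_re 0).comp (Computable.ofNat Nat.Partrec.Code)
  obtain ⟨f, hf, hfyes⟩ := h (fun n => ¬ halts n) (hre.of_eq fun n => not_not.symm)
  refine ComputablePred.halting_problem_not_re 0
    (REPred.of_eq (hP.comp (hf.comp Computable.encode)) fun c => ?_)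
  rw [hPyes, ← hfyes]
  simp [halts]

section Gadget

variable {k : ℕ} {j : Fin k} {i : Fin 2} {T : Tm k [] .bool}

/-- The term `i ⊕ ((1 - i) ⊕ T)` for the parameter `X_j`. Its series at `i` is
`X_j + X̄_j² · ⟦T⟧_i`. -/
def gadget (j : Fin k) (i : Fin 2) (T : Tm k [] .bool) : Tm k [] .bool :=
  .choice j (boolTm k [] i) (.choice j (boolTm k [] (1 - i)) T)

theorem code_gadget : (gadget j i T).code = Nat.pair 10 (Nat.pair j (Nat.pair (boolTm k [] i).code
    (Nat.pair 10 (Nat.pair j (Nat.pair (boolTm k [] (1 - i)).code T.code))))) := by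
  simp only [gadget, Tm.code]

theorem series_choice (M N : Tm k [] .bool) :
    (Tm.choice j M N).series i = (MvPowerSeries.X (j, true) : FPS (Param k)) * M.series i +
      (MvPowerSeries.X (j, false) : FPS (Param k)) * N.series i :=
  rfl

theorem series_boolTm (i j : Fin 2) : (boolTm k [] i).series j = if j = i then 1 else 0 :=
  interp_boolTm i j

theorem series_gadget :
    (gadget j i T).series i = (MvPowerSeries.X (j, true) : FPS (Param k)) +
      (MvPowerSeries.X (j, false) : FPS (Param k)) ^ 2 * T.series i := by
  have hi : i ≠ 1 - i := by fin_cases i <;> decide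
  rw [gadget, series_choice, series_choice, series_boolTm, series_boolTm, if_pos rfl, if_neg hi,
    mul_one, mul_zero, zero_add, ← mul_assoc, ← sq]

open scoped Pointwise in
theorem supp_series_gadget :
    FPS.supp ((gadget j i T).series i) = insert (Finsupp.single (j, true) 1)
      ({Finsupp.single (j, false) 2} + FPS.supp (T.series i)) := by
  have hsq : Finsupp.single (j, false) 1 + Finsupp.single (j, false) 1 =
      (Finsupp.single (j, false) 2 : Param k →₀ ℕ) := (Finsupp.single_add ..).symm
  rw [series_gadget, supp_add, sq, supp_mul, supp_mul, supp_X, supp_X, Set.singleton_add_singleton,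
    hsq, Set.singleton_union]

theorem boolEval_series_gadget :
    BoolEval ((gadget j i T).series i) {(j, true)}ᶜ ↔ BoolEval (T.series i) {(j, true)}ᶜ := by
  rw [series_gadget, boolEval_add, boolEval_mul, boolEval_pow two_ne_zero, boolEval_X, boolEval_X]
  simp

theorem tropDegree_gadget_eq_one (hT : ¬ BoolEval (T.series i) {(j, true)}ᶜ) :
    (gadget j i T).tropDegree i = 1 :=
  sInf_degreeSet_eq_one (by simp [supp_series_gadget]) (boolEval_series_gadget.not.2 hT)

theorem two_le_tropDegree_gadget (hT : BoolEval (T.series i) {(j, true)}ᶜ) :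
    2 ≤ (gadget j i T).tropDegree i := by
  refine le_sInf_degreeSet (boolEval_series_gadget.2 hT) ?_
  rw [supp_series_gadget, Set.singleton_add]
  rintro _ (rfl | ⟨ν, -, rfl⟩) hμ
  · simp at hμ
  · simp

theorem problemPi01Hard_of_gadget {d : ℕ} {yes : ℕ × Tm k [] .bool → Prop}
    (hyes : ∀ T : Tm k [] .bool, ¬ BoolEval (T.series i) {(j, true)}ᶜ ↔ yes (d, gadget j i T)) :
    ProblemPi01Hard instanceCode yes := by
  have hcode := primrec_natPair_const d <| primrec_natPair_const 10 <| primrec_natPair_const j <|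
    primrec_natPair_const (boolTm k [] i).code <| primrec_natPair_const 10 <|
      primrec_natPair_const j <| primrec_natPair_const (boolTm k [] (1 - i)).code .id
  exact (problemPi01Hard_not_boolEval_series _ i).of_reduction
    (g := fun T => (d, gadget j i T)) hcode.to_comp
    (fun _ => congrArg (Nat.pair d) code_gadget) hyes

end Gadget

theorem problemPi01Hard_tropDegree_lt {k : ℕ} (hk : 0 < k) (i : Fin 2) :
    ProblemPi01Hard instanceCode fun x : ℕ × Tm k [] .bool => x.2.tropDegree i < x.1 := by
  refine problemPi01Hard_of_gadget (i := i) (j := ⟨0, hk⟩) (d := 2) fun T =>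
    ⟨fun hT => ?_, fun h hT => ?_⟩
  · exact (tropDegree_gadget_eq_one hT).trans_lt one_lt_two
  · exact (two_le_tropDegree_gadget hT).not_gt h

theorem problemPi01Hard_tropDegree_eq {k : ℕ} (hk : 0 < k) (i : Fin 2) :
    ProblemPi01Hard instanceCode fun x : ℕ × Tm k [] .bool => x.2.tropDegree i = x.1 := by
  refine problemPi01Hard_of_gadget (i := i) (j := ⟨0, hk⟩) (d := 1) fun T =>
    ⟨fun hT => ?_, fun h hT => ?_⟩
  · exact tropDegree_gadget_eq_one hT
  · exact (two_le_tropDegree_gadget hT).not_gt (h.trans_lt one_lt_two)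

end PCFX

theorem mainTheorem3_general (k : ℕ) (hk : 0 < k) (i : Fin 2) :
    (¬ PCFX.ProblemRE PCFX.instanceCode
        (fun x : ℕ × PCFX.Tm k [] PCFX.Ty.bool => x.2.tropDegree i < x.1) ∧
      PCFX.ProblemPi01Hard PCFX.instanceCode
        (fun x : ℕ × PCFX.Tm k [] PCFX.Ty.bool => x.2.tropDegree i < x.1)) ∧
    (¬ PCFX.ProblemRE PCFX.instanceCode
        (fun x : ℕ × PCFX.Tm k [] PCFX.Ty.bool => x.2.tropDegree i = x.1) ∧
      PCFX.ProblemPi01Hard PCFX.instanceCode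
        (fun x : ℕ × PCFX.Tm k [] PCFX.Ty.bool => x.2.tropDegree i = x.1)) :=
  ⟨⟨(PCFX.problemPi01Hard_tropDegree_lt hk i).not_problemRE,
      PCFX.problemPi01Hard_tropDegree_lt hk i⟩,
    (PCFX.problemPi01Hard_tropDegree_eq hk i).not_problemRE,
    PCFX.problemPi01Hard_tropDegree_eq hk i⟩

theorem mainTheorem3 (k : ℕ) (hk : 2 ≤ k) (i : Fin 2) :
    (¬ PCFX.ProblemRE PCFX.instanceCode
        (fun x : ℕ × PCFX.Tm k [] PCFX.Ty.bool => x.2.tropDegree i < x.1) ∧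
      PCFX.ProblemPi01Hard PCFX.instanceCode
        (fun x : ℕ × PCFX.Tm k [] PCFX.Ty.bool => x.2.tropDegree i < x.1)) ∧
    (¬ PCFX.ProblemRE PCFX.instanceCode
        (fun x : ℕ × PCFX.Tm k [] PCFX.Ty.bool => x.2.tropDegree i = x.1) ∧
      PCFX.ProblemPi01Hard PCFX.instanceCode
        (fun x : ℕ × PCFX.Tm k [] PCFX.Ty.bool => x.2.tropDegree i = x.1)) :=
  mainTheorem3_general k (by omega) i
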